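/- Let $\mathbb{S}=\{x\in\mathbb{R}^3:\|x\|=1\}$ be the Euclidean unit sphere, $\sigma=(4\pi)^{-1}\mathrm{Vol}$ its uniform probability measure, and for $N\ge 2$ and $x=(x_1,\dots,x_N)\in\mathbb{S}^N$ let $$\mathscr{H}_N(x)=\sum_{i\ne j}\log\frac{1}{\|x_i-x_j\|}\in\mathbb{R}\cup\{+\infty\}$$ (sum over ordered pairs; the value is $+\infty$ when two points coincide). For $\beta>0$ the Coulomb gas on the sphere is the probability measure $$\mathbb{P}_{N,\beta}(dx)=\frac{1}{Z_{N,\beta}}e^{-\beta\mathscr{H}_N(x)}\,\sigma^{\otimes N}(dx),\qquad Z_{N,\beta}=\int_{\mathbb{S}^N}e^{-\beta\mathscr{H}_N(x)}\,\sigma^{\otimes N}(dx),$$ and $\mathbb{E}_\beta$ denotes expectation with respect to it. **Theorem.** Let $N\ge 2$ and $\beta\ge 1$, and let $x=(x_1,\dots,x_N)$ be a random configuration with law $\mathbb{P}_{N,\beta}$. For every constant $c>0$, with probability at least $1-e^{-\kappa N}$, where $$\kappa=c\,\frac{\beta}{N}\log N-\log\beta-8\log N,$$ one has $$\mathscr{H}_N(x_1,\dots,x_N)-\min_{\mathbb{S}^N}\mathscr{H}_N\le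 c\log N.$$ Moreover, the mean energy satisfies $$\mathbb{E}_\beta\big[\mathscr{H}_N(x_1,\dots,x_N)\big]-\min_{\mathbb{S}^N}\mathscr{H}_N\le\frac{N}{\beta}\big(\log\beta+8\log N\big).$$ -/

import Mathlib

open MeasureTheory

noncomputable section

namespace SphereGas

/-- The unit sphere of `ℝ³` with the Euclidean norm. -/
abbrev S2 : Type := Metric.sphere (0 : EuclideanSpace ℝ (Fin 3)) 1

/-- The uniform measure on the sphere, surface measure divided by `4π`. -/
def sigma : Measure S2 :=
  (ENNReal.ofReal (4 * Real.pi))⁻¹ • (volume : Measure (EuclideanSpace ℝ (Fin 3))).toSphere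

/-- The logarithmic energy, the sum over ordered pairs `i ≠ j` of `log (1 / ‖x i - x j‖)`.
It is extended-real valued: `1 / 0 = ∞` and `log ∞ = ⊤`, so it equals `⊤` exactly when two
points coincide. -/
def energy (N : ℕ) (x : Fin N → S2) : EReal :=
  ∑ p ∈ (Finset.univ : Finset (Fin N)).offDiag,
    ENNReal.log (1 / ‖(x p.1 : EuclideanSpace ℝ (Fin 3)) - x p.2‖ₑ)

/-- The Boltzmann weight `exp (-β H(x))`, equal to `0` where the energy is `⊤`. -/
def weight (N : ℕ) (β : ℝ) (x : Fin N → S2) : ENNReal :=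
  EReal.exp (-((β : EReal) * energy N x))

/-- The partition function. -/
def partitionFunction (N : ℕ) (β : ℝ) : ENNReal :=
  ∫⁻ x, weight N β x ∂(Measure.pi fun _ : Fin N => sigma)

/-- The Coulomb gas of `N` particles on the sphere at inverse temperature `β`. -/
def coulombGas (N : ℕ) (β : ℝ) : Measure (Fin N → S2) :=
  (partitionFunction N β)⁻¹ • (Measure.pi fun _ : Fin N => sigma).withDensity (weight N β)

end SphereGas

end

/-!
Write `F x = ∏_{i ≠ j} ‖x i - x j‖`, so that the energy is `-log F`, the Boltzmann weight is `F ^ β`,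
and the ground state energy is `m = -log (max F)`. Both estimates follow from one lower bound on
the partition function,
`Z ≥ exp (-β m - N (log β + 8 log N))` (`le_realPartition`).
Given this bound, the tail estimate is Markov's inequality (`coulombGas_real_lt_energy_le`), and the
mean estimate is the Gibbs variational inequality `β E[H] ≤ -log Z` (`mul_integral_energy_le`).

For the lower bound on `Z`, let the particles move independently and uniformly in spherical caps
of `σ`-measure about `s = 1 / (β N)` centred at the points of a minimizer. By Jensen's inequality,
`Z` is at least the volume of the product of caps times `exp (-β ·)` of the average energy over it.
The volume is at least `(s / 17) ^ N` (`le_sigma_cap`). The average energy hardly exceeds `m`, and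
this needs no separation of the points of the minimizer: on the sphere, averaging
`y ↦ log (1 / ‖x - y‖)` over the rotations about an axis `y₀` increases its value at `y₀` by at most
`log (2 / (1 + ⟪y₀, y⟫)) / 2`, uniformly in `x` (`lintegral_logKernel_spin_le`). Indeed the distance
from `x` to the point `y` rotated by `θ` is `q * |exp (i θ) - a|` with `a : ℂ` and
`q ^ 2 = ‖x - y₀‖ ^ 2 * (1 + ⟪y₀, y⟫) / 2` (`norm_sub_rotate_spin`), and the circle average of
`log |z - a|` is `log⁺ |a| ≥ 0`. Hence each ordered pair costs at most `log (1 / (1 - s))`, and the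
total cost, multiplied by `β`, is at most `N`.

The averages are taken of the nonnegative kernel `log (2 / ‖x - y‖)` with values in `[0, ∞]`, so that
finiteness of its integral yields both the integrability of `log F` and the positivity of `F` almost
everywhere.
-/

open MeasureTheory ProbabilityTheory
open scoped Pointwise

noncomputable section

namespace SphereGas

/-! ### Isometries, caps and the uniform measure -/

/-- The ambient Euclidean space. -/
abbrev E3 : Type := EuclideanSpace ℝ (Fin 3)

/-- The action of a linear isometry of the ambient space on the sphere. -/
def rotate (L : E3 ≃ₗᵢ[ℝ] E3) (x : S2) : S2 :=
  ⟨L x, by simp⟩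

@[simp]
lemma coe_rotate (L : E3 ≃ₗᵢ[ℝ] E3) (x : S2) : (rotate L x : E3) = L x := rfl

@[simp]
lemma rotate_rotate_symm (L : E3 ≃ₗᵢ[ℝ] E3) (x : S2) : rotate L (rotate L.symm x) = x :=
  Subtype.ext (by simp)

lemma continuous_rotate (L : E3 ≃ₗᵢ[ℝ] E3) : Continuous (rotate L) := by
  unfold rotate
  fun_prop

instance isProbabilityMeasure_sigma : IsProbabilityMeasure sigma := by
  constructor
  have h4 : (0 : ℝ) < 4 * Real.pi := by positivity
  rw [sigma, Measure.smul_apply, Measure.toSphere_apply_univ, EuclideanSpace.volume_ball_fin_three]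
  have : ((Module.finrank ℝ E3 : ℕ) : ENNReal) = ENNReal.ofReal 3 := by
    simp
  rw [this, ENNReal.ofReal_one, one_pow, one_mul, ← ENNReal.ofReal_mul (by norm_num), smul_eq_mul,
    show (3 : ℝ) * (Real.pi * 4 / 3) = 4 * Real.pi by ring]
  exact ENNReal.inv_mul_cancel (by simpa using Real.pi_pos) ENNReal.ofReal_ne_top

lemma measurePreserving_rotate (L : E3 ≃ₗᵢ[ℝ] E3) : MeasurePreserving (rotate L) sigma sigma := by
  refine ⟨(continuous_rotate L).measurable, ?_⟩
  ext s hs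
  rw [Measure.map_apply (continuous_rotate L).measurable hs, sigma, Measure.smul_apply,
    Measure.smul_apply, Measure.toSphere_apply' _ hs,
    Measure.toSphere_apply' _ ((continuous_rotate L).measurable hs)]
  have : Set.Ioo (0 : ℝ) 1 • ((↑) '' (rotate L ⁻¹' s) : Set E3)
      = L ⁻¹' (Set.Ioo (0 : ℝ) 1 • ((↑) '' s : Set E3)) := by
    ext v
    simp only [Set.mem_smul, Set.mem_image, Set.mem_preimage]
    constructor
    · rintro ⟨r, hr, _, ⟨y, hy, rfl⟩, rfl⟩
      exact ⟨r, hr, _, ⟨_, hy, rfl⟩, by simp⟩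
    · rintro ⟨r, hr, _, ⟨y, hy, rfl⟩, h⟩
      refine ⟨r, hr, _, ⟨rotate L.symm y, by simpa using hy, rfl⟩, ?_⟩
      apply L.injective
      rw [← h]; simp
  rw [this, L.measurePreserving.measure_preimage_emb L.toHomeomorph.measurableEmbedding]

/-- The open spherical cap of points whose inner product with `y₀` exceeds `t`. For
`t = 1 - 2 * s` its uniform measure is `s`, by Archimedes' hat-box theorem. -/
def cap (y₀ : S2) (t : ℝ) : Set S2 := {y | t < inner ℝ (y₀ : E3) (y : E3)}

lemma measurableSet_cap (y₀ : S2) (t : ℝ) : MeasurableSet (cap y₀ t) :=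
  (isOpen_lt continuous_const (by fun_prop)).measurableSet

lemma rotate_preimage_cap (L : E3 ≃ₗᵢ[ℝ] E3) (y₀ : S2) (t : ℝ) :
    rotate L ⁻¹' cap (rotate L y₀) t = cap y₀ t := by
  ext y
  simp [cap]

/-- The point `(0, 0, 1)`. -/
def northPole : S2 := ⟨EuclideanSpace.single 2 1, by simp⟩

lemma mem_cap_northPole {y : S2} {t : ℝ} : y ∈ cap northPole t ↔ t < (y : E3) 2 := by
  simp only [cap, northPole, Set.mem_ofPred_eq]
  rw [EuclideanSpace.inner_single_left]
  simp

lemma exists_rotate_northPole (y₀ : S2) : ∃ L : E3 ≃ₗᵢ[ℝ] E3, rotate L northPole = y₀ := by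
  obtain ⟨b, hb⟩ := Orthonormal.exists_orthonormalBasis_extension_of_card_eq (𝕜 := ℝ) (E := E3)
    (ι := Fin 3) (by simp) (v := fun _ => (y₀ : E3)) (s := {2}) (by
      constructor
      · rintro ⟨i, hi⟩; simp
      · rintro ⟨i, hi⟩ ⟨j, hj⟩ hij
        exact absurd (Subtype.ext (hi.trans hj.symm)) hij)
  refine ⟨b.repr.symm, Subtype.ext ?_⟩
  simpa [northPole] using hb 2 rfl

/-- A lower bound on the measure of a cap with the correct order in `s`. The cone over the cap contains
a box of volume `s / 4`; hence the constant `3 * (s / 4) / (4 * π) ≥ s / 17`. -/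
lemma le_sigma_cap_northPole {s : ℝ} (hs : 0 < s) (hs' : s ≤ 1 / 2) :
    ENNReal.ofReal (s / 17) ≤ sigma (cap northPole (1 - 2 * s)) := by
  -- the cone condition `1 - 2 * s < h / ‖(a, b, h)‖` follows from `h ^ 2 > 1 / 4` and
  -- `a ^ 2 + b ^ 2 < s / 2`, and `h < 3 / 4` keeps the box in the unit ball
  set w : ℝ := √s / 2 with hw
  have hw0 : 0 ≤ w := by positivity
  have hw2 : w ^ 2 = s / 4 := by rw [hw, div_pow, Real.sq_sqrt hs.le]; norm_num
  set B : Set (Fin 3 → ℝ) := Set.univ.pi fun i => Set.Ioo (![-w, -w, 1 / 2] i) (![w, w, 3 / 4] i)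
    with hB
  have hBm : MeasurableSet B := MeasurableSet.univ_pi fun i => measurableSet_Ioo
  have hvol : volume ((WithLp.ofLp : E3 → Fin 3 → ℝ) ⁻¹' B) = ENNReal.ofReal (s / 4) := by
    rw [(PiLp.volume_preserving_ofLp (Fin 3)).measure_preimage hBm.nullMeasurableSet, hB,
      Real.volume_pi_Ioo, Fin.prod_univ_three]
    simp only [Matrix.cons_val]
    rw [← ENNReal.ofReal_mul (by linarith), ← ENNReal.ofReal_mul (by nlinarith)]
    congr 1
    linear_combination hw2
  have hsub : ((WithLp.ofLp : E3 → Fin 3 → ℝ) ⁻¹' B) ⊆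
      Set.Ioo (0 : ℝ) 1 • (Subtype.val '' cap northPole (1 - 2 * s) : Set E3) := by
    intro p hp
    have h0 := hp 0 trivial
    have h1 := hp 1 trivial
    have h2 := hp 2 trivial
    simp only [Matrix.cons_val, Set.mem_Ioo] at h0 h1 h2
    have hn : ‖p‖ ^ 2 = p 0 ^ 2 + p 1 ^ 2 + p 2 ^ 2 := by
      rw [EuclideanSpace.norm_sq_eq, Fin.sum_univ_three]; simp
    have q0 : p 0 ^ 2 < s / 4 := by rw [← hw2]; exact sq_lt_sq' h0.1 h0.2
    have q1 : p 1 ^ 2 < s / 4 := by rw [← hw2]; exact sq_lt_sq' h1.1 h1.2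
    have hpos : 0 < ‖p‖ := by
      rw [norm_pos_iff]; rintro rfl; norm_num at h2
    have hlt : ‖p‖ < 1 := by
      rw [← abs_of_pos hpos, ← sq_lt_one_iff_abs_lt_one, hn]
      nlinarith
    refine Set.mem_smul.2 ⟨‖p‖, ⟨hpos, hlt⟩, ‖p‖⁻¹ • p, ⟨⟨‖p‖⁻¹ • p, ?_⟩, ?_, rfl⟩, ?_⟩
    · simp [norm_smul, hpos.ne']
    · rw [mem_cap_northPole]
      simp only [PiLp.smul_apply, smul_eq_mul]
      rw [inv_mul_eq_div, lt_div_iff₀ hpos]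
      refine lt_of_pow_lt_pow_left₀ 2 (by linarith) ?_
      rw [mul_pow, hn]
      have hh : 1 / 4 < p 2 ^ 2 := by nlinarith
      have : (1 - 2 * s) ^ 2 * (p 0 ^ 2 + p 1 ^ 2) ≤ p 0 ^ 2 + p 1 ^ 2 :=
        mul_le_of_le_one_left (by positivity) (by nlinarith)
      nlinarith [mul_pos hs (sub_pos.2 hh), mul_nonneg hs.le (by linarith : 0 ≤ 1 - 2 * s)]
    · simp [smul_smul, hpos.ne']
  rw [sigma, Measure.smul_apply, Measure.toSphere_apply' _ (measurableSet_cap _ _), smul_eq_mul]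
  have h3 : ((Module.finrank ℝ E3 : ℕ) : ENNReal) = ENNReal.ofReal 3 := by simp
  calc ENNReal.ofReal (s / 17) ≤ ENNReal.ofReal ((4 * Real.pi)⁻¹ * (3 * (s / 4))) := by
        apply ENNReal.ofReal_le_ofReal
        rw [inv_mul_eq_div, div_le_div_iff₀ (by norm_num) (by positivity)]
        nlinarith [Real.pi_lt_d2]
    _ = (ENNReal.ofReal (4 * Real.pi))⁻¹ * (ENNReal.ofReal 3 *
          volume ((WithLp.ofLp : E3 → Fin 3 → ℝ) ⁻¹' B)) := by
        rw [hvol, ENNReal.ofReal_mul (p := (4 * Real.pi)⁻¹) (by positivity),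
          ENNReal.ofReal_inv_of_pos (by positivity), ENNReal.ofReal_mul (p := 3) (by norm_num)]
    _ ≤ _ := by
        rw [h3]
        gcongr

lemma le_sigma_cap (y₀ : S2) {s : ℝ} (hs : 0 < s) (hs' : s ≤ 1 / 2) :
    ENNReal.ofReal (s / 17) ≤ sigma (cap y₀ (1 - 2 * s)) := by
  obtain ⟨L, rfl⟩ := exists_rotate_northPole y₀
  rw [← (measurePreserving_rotate L).measure_preimage (measurableSet_cap _ _).nullMeasurableSet,
    rotate_preimage_cap]
  exact le_sigma_cap_northPole hs hs'

/-! ### Averaging the logarithmic kernel over rotations about an axis -/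

/-- The rotation by the angle `θ` about the axis through the north pole. -/
def spin (θ : ℝ) : E3 ≃ₗᵢ[ℝ] E3 :=
  LinearIsometry.toLinearIsometryEquiv
    { toFun := fun v => !₂[Real.cos θ * v 0 - Real.sin θ * v 1,
        Real.sin θ * v 0 + Real.cos θ * v 1, v 2]
      map_add' := fun v w => by
        ext i; fin_cases i <;> simp <;> ring
      map_smul' := fun c v => by
        ext i; fin_cases i <;> simp <;> ring
      norm_map' := fun v => by
        rw [← sq_eq_sq₀ (norm_nonneg _) (norm_nonneg _), EuclideanSpace.norm_sq_eq,
          EuclideanSpace.norm_sq_eq, Fin.sum_univ_three, Fin.sum_univ_three]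
        simp
        linear_combination (v 0 ^ 2 + v 1 ^ 2) * Real.sin_sq_add_cos_sq θ }
    rfl

lemma spin_apply (θ : ℝ) (v : E3) :
    spin θ v = !₂[Real.cos θ * v 0 - Real.sin θ * v 1,
      Real.sin θ * v 0 + Real.cos θ * v 1, v 2] := rfl

@[simp]
lemma rotate_spin_northPole (θ : ℝ) : rotate (spin θ) northPole = northPole := by
  apply Subtype.ext
  rw [coe_rotate, spin_apply]
  ext i
  fin_cases i <;> simp [northPole]

lemma continuous_rotate_spin : Continuous fun p : ℝ × S2 => rotate (spin p.1) p.2 := by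
  unfold rotate
  refine Continuous.subtype_mk ?_ _
  simp only [spin_apply]
  refine (PiLp.continuous_toLp 2 _).comp (continuous_pi fun i => ?_)
  fin_cases i <;> simp <;> fun_prop

/-- The kernel `log (2 / ‖x - y‖)`, which is nonnegative because the sphere has diameter `2`; its value
on the diagonal is `⊤`. -/
def logKernel (x y : S2) : ENNReal :=
  if x = y then ⊤ else ENNReal.ofReal (Real.log (2 / ‖(x : E3) - y‖))

lemma logKernel_comm (x y : S2) : logKernel x y = logKernel y x := by
  simp only [logKernel, eq_comm (a := x), norm_sub_rev (x : E3)]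

lemma logKernel_rotate (L : E3 ≃ₗᵢ[ℝ] E3) (x y : S2) :
    logKernel (rotate L x) (rotate L y) = logKernel x y := by
  have h : rotate L x = rotate L y ↔ x = y := by
    simp [Subtype.ext_iff]
  simp only [logKernel, h, coe_rotate, ← map_sub, LinearIsometryEquiv.norm_map]

lemma measurable_logKernel : Measurable fun p : S2 × S2 => logKernel p.1 p.2 := by
  unfold logKernel
  refine Measurable.ite measurableSet_diagonal measurable_const ?_
  fun_prop

lemma norm_coe_sub_le_two (x y : S2) : ‖(x : E3) - y‖ ≤ 2 := by
  refine (norm_sub_le _ _).trans ?_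
  simp; norm_num

lemma norm_coe_sub_pos {x y : S2} (h : x ≠ y) : 0 < ‖(x : E3) - y‖ := by
  rw [norm_pos_iff, sub_ne_zero]
  exact fun h' => h (Subtype.ext h')

lemma coord_sq_sum (x : S2) :
    (x : E3) 0 ^ 2 + (x : E3) 1 ^ 2 + (x : E3) 2 ^ 2 = 1 := by
  have h : ‖(x : E3)‖ ^ 2 = 1 := by simp
  rw [EuclideanSpace.norm_sq_eq, Fin.sum_univ_three] at h
  simpa using h

lemma norm_sub_northPole_sq (x : S2) :
    ‖(x : E3) - northPole‖ ^ 2 = 2 * (1 - (x : E3) 2) := by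
  rw [EuclideanSpace.norm_sq_eq, Fin.sum_univ_three]
  simp [northPole]
  linear_combination coord_sq_sum x

/-- As `y` turns about the polar axis, its distance to `x` is a constant multiple of the distance from
a point moving on the unit circle to a fixed `a : ℂ`. With `X = x 0 + i x 1`, `Y = y 0 + i y 1` and
`Q = (1 - x 2) * (1 + y 2)`, the point is `a = X * conj Y / Q`. -/
lemma norm_sub_rotate_spin (x y : S2) (hx : (x : E3) 2 < 1) (hy : -1 < (y : E3) 2) :
    ∃ a : ℂ, ∀ θ : ℝ, ‖(x : E3) - rotate (spin θ) y‖ =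
      √((1 - (x : E3) 2) * (1 + (y : E3) 2)) * ‖circleMap 0 1 θ - a‖ := by
  set Q : ℝ := (1 - (x : E3) 2) * (1 + (y : E3) 2) with hQ
  have hQ0 : 0 < Q := mul_pos (by linarith) (by linarith)
  refine ⟨⟨((x : E3) 0 * (y : E3) 0 + (x : E3) 1 * (y : E3) 1) / Q,
    ((x : E3) 1 * (y : E3) 0 - (x : E3) 0 * (y : E3) 1) / Q⟩, fun θ => ?_⟩
  rw [← sq_eq_sq₀ (norm_nonneg _) (by positivity), mul_pow, Real.sq_sqrt hQ0.le,
    Complex.sq_norm, Complex.normSq_apply, EuclideanSpace.norm_sq_eq, Fin.sum_univ_three]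
  simp only [coe_rotate, spin_apply, circleMap, Complex.exp_mul_I, PiLp.sub_apply,
    Real.norm_eq_abs, sq_abs]
  simp [← Complex.ofReal_cos, ← Complex.ofReal_sin]
  have hxs := coord_sq_sum x
  have hys := coord_sq_sum y
  have hcs := Real.sin_sq_add_cos_sq θ
  generalize (x : E3) 0 = x0 at *
  generalize (x : E3) 1 = x1 at *
  generalize (x : E3) 2 = x2 at *
  generalize (y : E3) 0 = y0 at *
  generalize (y : E3) 1 = y1 at *
  generalize (y : E3) 2 = y2 at *
  generalize Real.cos θ = c at *
  generalize Real.sin θ = s at *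
  have e : (x0 * y0 + x1 * y1) ^ 2 + (x1 * y0 - x0 * y1) ^ 2 = Q * ((1 + x2) * (1 - y2)) := by
    have : (x0 * y0 + x1 * y1) ^ 2 + (x1 * y0 - x0 * y1) ^ 2
      = (x0 ^ 2 + x1 ^ 2) * (y0 ^ 2 + y1 ^ 2) := by ring
    rw [this, hQ, show x0 ^ 2 + x1 ^ 2 = 1 - x2 ^ 2 by linarith,
      show y0 ^ 2 + y1 ^ 2 = 1 - y2 ^ 2 by linarith]
    ring
  have e' : Q * ((c - (x0 * y0 + x1 * y1) / Q) * (c - (x0 * y0 + x1 * y1) / Q)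
      + (s - (x1 * y0 - x0 * y1) / Q) * (s - (x1 * y0 - x0 * y1) / Q))
      = Q * (s ^ 2 + c ^ 2) - 2 * (c * (x0 * y0 + x1 * y1) + s * (x1 * y0 - x0 * y1))
        + ((x0 * y0 + x1 * y1) ^ 2 + (x1 * y0 - x0 * y1) ^ 2) / Q := by
    field_simp
    ring
  rw [e', e, hcs, mul_div_cancel_left₀ _ hQ0.ne', hQ]
  linear_combination hxs + hys + (y0 ^ 2 + y1 ^ 2) * hcs

/-- The average of the kernel over the parallel through `y` is at most its value at the pole plus
an error that does not depend on `x`, however close `x` is to the pole or to the parallel. -/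
lemma lintegral_logKernel_spin_le (x y : S2) (hy : -1 < (y : E3) 2) :
    ∫⁻ θ in Set.Ioc 0 (2 * Real.pi), logKernel x (rotate (spin θ) y) ≤
      ENNReal.ofReal (2 * Real.pi) * (logKernel x northPole +
        ENNReal.ofReal (Real.log (2 / (1 + (y : E3) 2)) / 2)) := by
  have h2pi : 0 < 2 * Real.pi := by positivity
  by_cases hx : x = northPole
  · have : logKernel x northPole = ⊤ := by simp [logKernel, hx]
    rw [this, top_add, ENNReal.mul_top (by simpa using Real.pi_pos)]
    exact le_top
  have hdist := norm_coe_sub_pos hx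
  have hdist2 := norm_sub_northPole_sq x
  have hx2 : (x : E3) 2 < 1 := by nlinarith [sq_pos_of_pos hdist]
  have hy2 : (y : E3) 2 ≤ 1 := by
    have h := coord_sq_sum y
    have h0 := sq_nonneg ((y : E3) 0)
    have h1 := sq_nonneg ((y : E3) 1)
    nlinarith
  obtain ⟨a, ha⟩ := norm_sub_rotate_spin x y hx2 hy
  set Q : ℝ := (1 - (x : E3) 2) * (1 + (y : E3) 2) with hQ
  have hQ0 : 0 < Q := mul_pos (by linarith) (by linarith)
  have hq0 : 0 < √Q := Real.sqrt_pos.2 hQ0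
  set f : ℝ → ℝ := fun θ => Real.log ‖circleMap 0 1 θ - a‖ with hf
  have hfint : IntervalIntegrable f volume 0 (2 * Real.pi) :=
    circleIntegrable_log_norm_sub_const (a := a) (c := 0) 1
  have hfav : 0 ≤ ∫ θ in 0..2 * Real.pi, f θ := by
    have h := circleAverage_log_norm_sub_const_eq_posLog (a := a)
    rw [Real.circleAverage_def, smul_eq_mul, inv_mul_eq_div, div_eq_iff h2pi.ne'] at h
    change ∫ θ in 0..2 * Real.pi, f θ = _ at h
    rw [h]
    exact mul_nonneg Real.posLog_nonneg h2pi.le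
  -- the kernel is `⊤` where the circle meets `a`, which is a null set of angles
  have hne : ∀ᵐ θ ∂(volume.restrict (Set.Ioc 0 (2 * Real.pi))), circleMap 0 1 θ ≠ a := by
    refine ae_restrict_of_ae ?_
    exact ((Set.countable_singleton a).preimage_circleMap 0 one_ne_zero).ae_notMem volume
  have hlog : ∀ θ, circleMap 0 1 θ ≠ a →
      logKernel x (rotate (spin θ) y) = ENNReal.ofReal (Real.log 2 - Real.log √Q - f θ) ∧
      0 ≤ Real.log 2 - Real.log √Q - f θ := by
    intro θ hθ
    have hp : 0 < ‖circleMap 0 1 θ - a‖ := norm_pos_iff.2 (sub_ne_zero.2 hθ)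
    have hpos : 0 < ‖(x : E3) - rotate (spin θ) y‖ := by rw [ha]; positivity
    have hneq : x ≠ rotate (spin θ) y := by
      rintro h
      rw [← h] at hpos
      simp at hpos
    have e : Real.log (2 / ‖(x : E3) - rotate (spin θ) y‖)
        = Real.log 2 - Real.log √Q - f θ := by
      rw [Real.log_div two_ne_zero hpos.ne', ha, Real.log_mul hq0.ne' hp.ne']
      ring
    refine ⟨by rw [logKernel, if_neg hneq, e], ?_⟩
    rw [← e]
    apply Real.log_nonneg
    rw [le_div_iff₀ hpos, one_mul]
    exact norm_coe_sub_le_two _ _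
  have hint : IntegrableOn (fun θ => Real.log 2 - Real.log √Q - f θ)
      (Set.Ioc 0 (2 * Real.pi)) := by
    refine Integrable.sub (integrable_const _) ?_
    exact (intervalIntegrable_iff_integrableOn_Ioc_of_le h2pi.le).1 hfint
  rw [lintegral_congr_ae (hne.mono fun θ hθ => (hlog θ hθ).1),
    ← ofReal_integral_eq_lintegral_ofReal hint (hne.mono fun θ hθ => (hlog θ hθ).2),
    ← intervalIntegral.integral_of_le h2pi.le,
    intervalIntegral.integral_sub (by simp) hfint, logKernel, if_neg hx,
    ← ENNReal.ofReal_add, ← ENNReal.ofReal_mul h2pi.le]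
  · apply ENNReal.ofReal_le_ofReal
    have e : Real.log (2 / ‖(x : E3) - northPole‖) + Real.log (2 / (1 + (y : E3) 2)) / 2
        = Real.log 2 - Real.log √Q := by
      have h1 : Real.log √Q = Real.log Q / 2 := Real.log_sqrt hQ0.le
      have h2 : Q * 2 = ‖(x : E3) - northPole‖ ^ 2 * (1 + (y : E3) 2) := by
        rw [hdist2, hQ]; ring
      have h3 := congrArg Real.log h2
      rw [Real.log_mul hQ0.ne' two_ne_zero,
        Real.log_mul (x := ‖(x : E3) - northPole‖ ^ 2) (by positivity) (by linarith),
        Real.log_pow] at h3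
      rw [Real.log_div two_ne_zero hdist.ne', Real.log_div two_ne_zero (by linarith), h1]
      push_cast at h3
      linarith
    rw [e]
    simp
    linarith
  · apply Real.log_nonneg
    rw [le_div_iff₀ hdist, one_mul]
    exact norm_coe_sub_le_two _ _
  · refine div_nonneg (Real.log_nonneg ?_) zero_le_two
    rw [le_div_iff₀ (by linarith)]
    linarith

/-- Averaging over the rotations first is harmless, since they preserve the cap and the measure. -/
lemma setLIntegral_logKernel_cap_northPole_le (x : S2) {s : ℝ} (hs : s < 1) :
    ∫⁻ y in cap northPole (1 - 2 * s), logKernel x y ∂sigma ≤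
      sigma (cap northPole (1 - 2 * s)) * (logKernel x northPole +
        ENNReal.ofReal (Real.log (1 / (1 - s)) / 2)) := by
  set D := cap northPole (1 - 2 * s) with hD
  have hmeas : Measurable fun p : ℝ × S2 => logKernel x (rotate (spin p.1) p.2) :=
    measurable_logKernel.comp (measurable_const.prodMk continuous_rotate_spin.measurable)
  have hinv : ∀ θ, ∫⁻ y in D, logKernel x (rotate (spin θ) y) ∂sigma
      = ∫⁻ y in D, logKernel x y ∂sigma := by
    intro θ
    have h := (measurePreserving_rotate (spin θ)).setLIntegral_comp_preimage
      (measurableSet_cap northPole (1 - 2 * s))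
      (measurable_logKernel.comp (measurable_prodMk_left (x := x)))
    have h' := rotate_preimage_cap (spin θ) northPole (1 - 2 * s)
    rw [rotate_spin_northPole] at h'
    rw [h'] at h
    exact h
  have h2pi : ENNReal.ofReal (2 * Real.pi) ≠ 0 := by simpa using Real.pi_pos
  rw [← ENNReal.mul_le_mul_iff_right h2pi ENNReal.ofReal_ne_top]
  calc ENNReal.ofReal (2 * Real.pi) * ∫⁻ y in D, logKernel x y ∂sigma
      = ∫⁻ θ in Set.Ioc 0 (2 * Real.pi), ∫⁻ y in D, logKernel x (rotate (spin θ) y) ∂sigma := by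
        simp_rw [hinv]
        simp [mul_comm]
    _ = ∫⁻ y in D, ∫⁻ θ in Set.Ioc 0 (2 * Real.pi), logKernel x (rotate (spin θ) y) ∂volume
          ∂sigma :=
        lintegral_lintegral_swap hmeas.aemeasurable
    _ ≤ ∫⁻ y in D, ENNReal.ofReal (2 * Real.pi) * (logKernel x northPole +
        ENNReal.ofReal (Real.log (1 / (1 - s)) / 2)) ∂sigma := by
        refine setLIntegral_mono' (measurableSet_cap _ _) fun y hy => ?_
        rw [mem_cap_northPole] at hy
        refine (lintegral_logKernel_spin_le x y (by linarith)).trans ?_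
        gcongr ENNReal.ofReal (2 * Real.pi) * (_ + ENNReal.ofReal (Real.log ?_ / 2))
        · exact div_pos two_pos (by linarith)
        · rw [div_le_div_iff₀ (by linarith) (by linarith)]
          linarith
    _ = _ := by
        rw [setLIntegral_const]; ring

lemma setLIntegral_logKernel_cap_le (x y₀ : S2) {s : ℝ} (hs : s < 1) :
    ∫⁻ y in cap y₀ (1 - 2 * s), logKernel x y ∂sigma ≤
      sigma (cap y₀ (1 - 2 * s)) * (logKernel x y₀ +
        ENNReal.ofReal (Real.log (1 / (1 - s)) / 2)) := by
  obtain ⟨L, rfl⟩ := exists_rotate_northPole y₀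
  have h := setLIntegral_logKernel_cap_northPole_le (rotate L.symm x) hs
  rw [← rotate_preimage_cap L, (measurePreserving_rotate L).measure_preimage
    (measurableSet_cap _ _).nullMeasurableSet, ← logKernel_rotate L, rotate_rotate_symm] at h
  rw [← (measurePreserving_rotate L).setLIntegral_comp_preimage (measurableSet_cap _ _)
    (f := fun y => logKernel x y)
    (measurable_logKernel.comp (measurable_prodMk_left (x := x)))]
  convert h using 3 with y
  rw [← logKernel_rotate L (rotate L.symm x) y, rotate_rotate_symm]

/-! ### The energy as a logarithm of the product of distances -/

/-- The product of the distances over ordered pairs of distinct indices; the energy is minus its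
logarithm. -/
def distProd (N : ℕ) (x : Fin N → S2) : ℝ :=
  ∏ p ∈ (Finset.univ : Finset (Fin N)).offDiag, ‖(x p.1 : E3) - x p.2‖

lemma continuous_distProd (N : ℕ) : Continuous (distProd N) := by
  unfold distProd
  fun_prop

lemma distProd_nonneg {N : ℕ} (x : Fin N → S2) : 0 ≤ distProd N x :=
  Finset.prod_nonneg fun _ _ => norm_nonneg _

lemma distProd_pos_of_injective {N : ℕ} {x : Fin N → S2} (hx : Function.Injective x) :
    0 < distProd N x :=
  Finset.prod_pos fun _ hp => norm_coe_sub_pos (hx.ne (Finset.mem_offDiag.1 hp).2.2)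

lemma ennreal_log_prod {ι : Type*} (s : Finset ι) (f : ι → ENNReal) :
    ENNReal.log (∏ i ∈ s, f i) = ∑ i ∈ s, ENNReal.log (f i) := by
  classical
  induction s using Finset.induction_on with
  | empty => simp
  | insert a s ha ih => rw [Finset.prod_insert ha, Finset.sum_insert ha, ENNReal.log_mul_add, ih]

lemma energy_eq_neg_log (N : ℕ) (x : Fin N → S2) :
    energy N x = -ENNReal.log (ENNReal.ofReal (distProd N x)) := by
  rw [energy, ← ennreal_log_prod, ← ENNReal.log_inv, distProd,
    ENNReal.ofReal_prod_of_nonneg fun _ _ => norm_nonneg _, ENNReal.prod_inv_distrib]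
  · simp
  · intro p _ q _ _
    simp

lemma energy_eq_coe {N : ℕ} {x : Fin N → S2} (hx : 0 < distProd N x) :
    energy N x = ((-Real.log (distProd N x) : ℝ) : EReal) := by
  rw [energy_eq_neg_log, ENNReal.log_ofReal_of_pos hx, EReal.coe_neg]

lemma energy_eq_top {N : ℕ} {x : Fin N → S2} (hx : distProd N x = 0) : energy N x = ⊤ := by
  rw [energy_eq_neg_log, hx]
  simp

/-- This holds also where the energy is `⊤`: there both sides are `0`, as `Real.log 0 = 0`. -/
lemma energy_toReal (N : ℕ) (x : Fin N → S2) :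
    (energy N x).toReal = -Real.log (distProd N x) := by
  rcases (distProd_nonneg x).eq_or_lt' with h | h
  · simp [energy_eq_top h, h]
  · rw [energy_eq_coe h, EReal.toReal_coe]

lemma weight_eq (N : ℕ) {β : ℝ} (hβ : 0 ≤ β) (x : Fin N → S2) :
    weight N β x = ENNReal.ofReal (distProd N x ^ β) := by
  rw [weight, energy_eq_neg_log, mul_neg, neg_neg, ← ENNReal.rpow_eq_exp_mul_log,
    ENNReal.ofReal_rpow_of_nonneg (distProd_nonneg x) hβ]

lemma integrable_of_continuous {N : ℕ} {μ : Measure (Fin N → S2)} [IsFiniteMeasure μ]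
    {f : (Fin N → S2) → ℝ} (hf : Continuous f) : Integrable f μ :=
  hf.integrable_of_hasCompactSupport (HasCompactSupport.of_compactSpace f)

lemma continuous_distProd_rpow (N : ℕ) {β : ℝ} (hβ : 0 ≤ β) :
    Continuous fun x => distProd N x ^ β :=
  (continuous_distProd N).rpow_const fun _ => Or.inr hβ

/-! ### Jensen's inequality over a product of caps -/

/-- The energy shifted by `N * (N - 1) * log 2`, which makes it nonnegative, with values in `[0, ∞]`. -/
def kernelSum (N : ℕ) (x : Fin N → S2) : ENNReal :=
  ∑ p ∈ (Finset.univ : Finset (Fin N)).offDiag, logKernel (x p.1) (x p.2)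

lemma measurable_logKernel_eval {N : ℕ} (i j : Fin N) :
    Measurable fun x : Fin N → S2 => logKernel (x i) (x j) :=
  measurable_logKernel.comp
    (f := fun x : Fin N → S2 => (x i, x j)) (by fun_prop)

lemma measurable_kernelSum (N : ℕ) : Measurable (kernelSum N) :=
  Finset.measurable_fun_sum _ fun p _ => measurable_logKernel_eval p.1 p.2

lemma card_offDiag_fin (N : ℕ) :
    (((Finset.univ : Finset (Fin N)).offDiag.card : ℕ) : ℝ) = N * (N - 1) := by
  rw [Finset.offDiag_card, Nat.cast_sub (by simp; exact Nat.le_mul_self N)]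
  simp
  ring

lemma distProd_pos_of_kernelSum_ne_top {N : ℕ} {x : Fin N → S2} (hx : kernelSum N x ≠ ⊤) :
    0 < distProd N x := by
  refine Finset.prod_pos fun p hp => norm_coe_sub_pos fun h => ?_
  have := ENNReal.sum_ne_top.1 hx p hp
  simp [logKernel, h] at this

lemma kernelSum_eq {N : ℕ} {x : Fin N → S2} (hx : 0 < distProd N x) :
    0 ≤ N * (N - 1) * Real.log 2 - Real.log (distProd N x) ∧
    kernelSum N x = ENNReal.ofReal (N * (N - 1) * Real.log 2 - Real.log (distProd N x)) := by
  have hne : ∀ p ∈ (Finset.univ : Finset (Fin N)).offDiag, ‖(x p.1 : E3) - x p.2‖ ≠ 0 :=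
    Finset.prod_ne_zero_iff.1 hx.ne'
  have hnn : ∀ p ∈ (Finset.univ : Finset (Fin N)).offDiag,
      0 ≤ Real.log (2 / ‖(x p.1 : E3) - x p.2‖) := by
    intro p hp
    apply Real.log_nonneg
    rw [le_div_iff₀ ((norm_nonneg _).lt_of_ne' (hne p hp)), one_mul]
    exact norm_coe_sub_le_two _ _
  have hsum : N * (N - 1) * Real.log 2 - Real.log (distProd N x)
      = ∑ p ∈ (Finset.univ : Finset (Fin N)).offDiag,
        Real.log (2 / ‖(x p.1 : E3) - x p.2‖) := by
    have hcard := card_offDiag_fin N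
    rw [distProd, Real.log_prod hne, ← hcard, ← nsmul_eq_mul, ← Finset.sum_const,
      ← Finset.sum_sub_distrib]
    exact Finset.sum_congr rfl fun p hp => (Real.log_div two_ne_zero (hne p hp)).symm
  rw [hsum]
  refine ⟨Finset.sum_nonneg hnn, ?_⟩
  rw [ENNReal.ofReal_sum_of_nonneg hnn, kernelSum]
  refine Finset.sum_congr rfl fun p hp => ?_
  rw [logKernel, if_neg]
  intro h
  exact hne p hp (by simp [h])

lemma sigma_cap_ne_zero (y₀ : S2) {s : ℝ} (hs : 0 < s) (hs' : s ≤ 1 / 2) :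
    sigma (cap y₀ (1 - 2 * s)) ≠ 0 := by
  have := le_sigma_cap y₀ hs hs'
  have h0 : 0 < ENNReal.ofReal (s / 17) := by simpa using hs
  exact (h0.trans_le this).ne'

lemma lintegral_logKernel_cond_cap_le (x y₀ : S2) {s : ℝ} (hs : 0 < s) (hs' : s ≤ 1 / 2) :
    ∫⁻ y, logKernel x y ∂(cond sigma (cap y₀ (1 - 2 * s))) ≤
      logKernel x y₀ + ENNReal.ofReal (Real.log (1 / (1 - s)) / 2) := by
  rw [ProbabilityTheory.cond, lintegral_smul_measure, smul_eq_mul]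
  refine (mul_le_mul_right (setLIntegral_logKernel_cap_le x y₀ (by linarith)) _).trans ?_
  rw [← mul_assoc, ENNReal.inv_mul_cancel (sigma_cap_ne_zero y₀ hs hs') (measure_ne_top _ _),
    one_mul]

lemma lintegral_pair_pi {N : ℕ} (ν : Fin N → Measure S2) [∀ i, IsProbabilityMeasure (ν i)]
    {i j : Fin N} (hij : i ≠ j) {f : S2 × S2 → ENNReal} (hf : Measurable f) :
    ∫⁻ z, f (z i, z j) ∂(Measure.pi ν) = ∫⁻ x, ∫⁻ y, f (x, y) ∂(ν j) ∂(ν i) := by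
  have hind : IndepFun (fun z : Fin N → S2 => z i) (fun z => z j) (Measure.pi ν) :=
    (iIndepFun_pi (μ := ν) (X := fun _ => id) fun _ => aemeasurable_id).indepFun hij
  have hmap := (indepFun_iff_map_prod_eq_prod_map_map (measurable_pi_apply i).aemeasurable
    (measurable_pi_apply j).aemeasurable).1 hind
  have hi : (Measure.pi ν).map (fun z : Fin N → S2 => z i) = ν i :=
    (measurePreserving_eval ν i).map_eq
  have hj : (Measure.pi ν).map (fun z : Fin N → S2 => z j) = ν j :=
    (measurePreserving_eval ν j).map_eq
  rw [hi, hj] at hmap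
  rw [← lintegral_prod _ hf.aemeasurable, ← hmap,
    lintegral_map hf ((measurable_pi_apply i).prodMk (measurable_pi_apply j))]

/-- When the points of `x₀` move independently and uniformly in caps, the two points of each pair
are averaged one after the other, at a cost of `log (1 / (1 - s)) / 2` each. -/
lemma lintegral_kernelSum_le {N : ℕ} (x₀ : Fin N → S2) {s : ℝ} (hs : 0 < s) (hs' : s ≤ 1 / 2)
    (hx₀ : 0 < distProd N x₀) :
    ∫⁻ z, kernelSum N z ∂(Measure.pi fun i => cond sigma (cap (x₀ i) (1 - 2 * s))) ≤
      ENNReal.ofReal (N * (N - 1) * Real.log 2 - Real.log (distProd N x₀) +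
        N * (N - 1) * Real.log (1 / (1 - s))) := by
  have hprob : ∀ i, IsProbabilityMeasure (cond sigma (cap (x₀ i) (1 - 2 * s))) := fun i =>
    cond_isProbabilityMeasure (sigma_cap_ne_zero _ hs hs')
  have hl : 0 ≤ Real.log (1 / (1 - s)) := by
    apply Real.log_nonneg
    rw [le_div_iff₀ (by linarith)]; linarith
  set ε := ENNReal.ofReal (Real.log (1 / (1 - s)) / 2) with hε
  have hεε : ε + ε = ENNReal.ofReal (Real.log (1 / (1 - s))) := by
    rw [hε, ← ENNReal.ofReal_add (by linarith) (by linarith), add_halves]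
  have hpair : ∀ p ∈ (Finset.univ : Finset (Fin N)).offDiag,
      ∫⁻ z, logKernel (z p.1) (z p.2) ∂(Measure.pi fun i => cond sigma (cap (x₀ i) (1 - 2 * s)))
        ≤ logKernel (x₀ p.1) (x₀ p.2) + ENNReal.ofReal (Real.log (1 / (1 - s))) := by
    intro p hp
    rw [lintegral_pair_pi (fun i => cond sigma (cap (x₀ i) (1 - 2 * s)))
      (Finset.mem_offDiag.1 hp).2.2 measurable_logKernel]
    calc _ ≤ ∫⁻ x, (logKernel x (x₀ p.2) + ε) ∂(cond sigma (cap (x₀ p.1) (1 - 2 * s))) :=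
          lintegral_mono fun x => lintegral_logKernel_cond_cap_le x (x₀ p.2) hs hs'
      _ = ∫⁻ x, logKernel (x₀ p.2) x ∂(cond sigma (cap (x₀ p.1) (1 - 2 * s))) + ε := by
          rw [lintegral_add_right _ measurable_const, lintegral_const, measure_univ, mul_one]
          simp_rw [logKernel_comm _ (x₀ p.2)]
      _ ≤ (logKernel (x₀ p.2) (x₀ p.1) + ε) + ε := by
          gcongr
          exact lintegral_logKernel_cond_cap_le _ _ hs hs'
      _ = _ := by rw [add_assoc, hεε, logKernel_comm]
  obtain ⟨hk0, hk⟩ := kernelSum_eq hx₀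
  unfold kernelSum
  rw [lintegral_finsetSum _ fun p _ => measurable_logKernel_eval p.1 p.2]
  refine (Finset.sum_le_sum hpair).trans ?_
  rw [Finset.sum_add_distrib, Finset.sum_const, nsmul_eq_mul]
  change kernelSum N x₀ + _ ≤ _
  have hcard := card_offDiag_fin N
  rw [hk, ← hcard, ENNReal.ofReal_add (by rw [hcard]; exact hk0) (by positivity),
    ENNReal.ofReal_mul (p := ((Finset.univ : Finset (Fin N)).offDiag.card : ℝ)) (by positivity),
    ENNReal.ofReal_natCast]

/-- Jensen's inequality for `exp`, by integration of the tangent line inequality. The bound on the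
integral of `kernelSum` also shows that `distProd` is positive almost everywhere. -/
lemma ofReal_exp_le_lintegral_distProd_rpow {N : ℕ} (μ : Measure (Fin N → S2))
    [IsProbabilityMeasure μ] {β : ℝ} (hβ : 0 ≤ β) {A : ℝ} (hA : 0 ≤ A)
    (h : ∫⁻ z, kernelSum N z ∂μ ≤ ENNReal.ofReal A) :
    ENNReal.ofReal (Real.exp (β * (N * (N - 1) * Real.log 2 - A))) ≤
      ∫⁻ z, ENNReal.ofReal (distProd N z ^ β) ∂μ := by
  have hfin : ∫⁻ z, kernelSum N z ∂μ ≠ ⊤ := (h.trans_lt ENNReal.ofReal_lt_top).ne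
  have hae : ∀ᵐ z ∂μ, kernelSum N z < ⊤ := ae_lt_top (measurable_kernelSum N) hfin
  set K : ℝ := N * (N - 1) * Real.log 2 with hK
  set v : (Fin N → S2) → ℝ := fun z => (kernelSum N z).toReal with hv
  have hvint : Integrable v μ := integrable_toReal_of_lintegral_ne_top
    (measurable_kernelSum N).aemeasurable hfin
  have hvle : ∫ z, v z ∂μ ≤ A := by
    rw [hv, integral_toReal (measurable_kernelSum N).aemeasurable hae]
    exact ENNReal.toReal_le_of_le_ofReal hA h
  have hDint : Integrable (fun z => distProd N z ^ β) μ :=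
    integrable_of_continuous (continuous_distProd_rpow N hβ)
  rw [← ofReal_integral_eq_lintegral_ofReal hDint
    (ae_of_all _ fun z => Real.rpow_nonneg (distProd_nonneg z) β)]
  apply ENNReal.ofReal_le_ofReal
  set E := Real.exp (β * (K - A)) with hE
  -- the tangent line of `exp` at `β * (K - A)`
  have hle : ∀ᵐ z ∂μ, E * (1 + β * A) - E * β * v z ≤ distProd N z ^ β := by
    filter_upwards [hae] with z hz
    have hpos := distProd_pos_of_kernelSum_ne_top hz.ne
    obtain ⟨h0, hk⟩ := kernelSum_eq hpos
    have hvz : v z = K - Real.log (distProd N z) := by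
      rw [hv]; simp only; rw [hk, ENNReal.toReal_ofReal h0]
    have hexp : distProd N z ^ β = E * Real.exp (β * (A - v z)) := by
      rw [Real.rpow_def_of_pos hpos, hE, ← Real.exp_add, hvz]
      congr 1; ring
    rw [hexp]
    have := Real.add_one_le_exp (β * (A - v z))
    have hE0 : 0 ≤ E := (Real.exp_pos _).le
    nlinarith
  have hint : Integrable (fun z => E * (1 + β * A) - E * β * v z) μ :=
    (integrable_const _).sub (hvint.const_mul _)
  refine le_trans ?_ (integral_mono_ae hint hDint hle)
  rw [integral_sub (integrable_const _) (hvint.const_mul _), integral_const,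
    integral_const_mul, probReal_univ, one_smul]
  have : E * β * ∫ z, v z ∂μ ≤ E * β * A :=
    mul_le_mul_of_nonneg_left hvle (mul_nonneg (Real.exp_pos _).le hβ)
  linarith

/-- The product of the uniform measures on the sets `D i` is, up to normalization, the restriction of
`σ^N` to the product of these sets. -/
lemma prod_smul_pi_cond {N : ℕ} (D : Fin N → Set S2) (hD : ∀ i, MeasurableSet (D i))
    (h0 : ∀ i, sigma (D i) ≠ 0) :
    (∏ i, sigma (D i)) • (Measure.pi fun i => cond sigma (D i)) =
      (Measure.pi fun _ : Fin N => sigma).restrict (Set.univ.pi D) := by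
  have hprob : ∀ i, IsProbabilityMeasure (cond sigma (D i)) := fun i =>
    cond_isProbabilityMeasure (h0 i)
  rw [Measure.restrict_pi_pi]
  refine (Measure.pi_eq fun s hs => ?_).symm
  rw [Measure.smul_apply, Measure.pi_pi, smul_eq_mul, ← Finset.prod_mul_distrib]
  refine Finset.prod_congr rfl fun i _ => ?_
  rw [Measure.restrict_apply (hs i), mul_comm, cond_mul_eq_inter (hD i), Set.inter_comm]

/-- The caps of measure about `s = 1 / (β * N)` balance the entropy `-N * log s` against the energy
cost, which is then at most `N`; the slack `7 * log N ≥ log 17 + 1` absorbs the constants. -/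
lemma le_partitionFunction {N : ℕ} (hN : 2 ≤ N) {β : ℝ} (hβ : 1 ≤ β) {x₀ : Fin N → S2}
    (hx₀ : 0 < distProd N x₀) :
    ENNReal.ofReal (Real.exp (β * Real.log (distProd N x₀)
      - N * (Real.log β + 8 * Real.log N))) ≤ partitionFunction N β := by
  have hN' : (2 : ℝ) ≤ N := by exact_mod_cast hN
  have hβN : 2 ≤ β * N := by nlinarith
  set s : ℝ := 1 / (β * N) with hs_def
  have hs : 0 < s := by positivity
  have hs' : s ≤ 1 / 2 := one_div_le_one_div_of_le two_pos hβN
  set D : Fin N → Set S2 := fun i => cap (x₀ i) (1 - 2 * s) with hD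
  have hprob : ∀ i, IsProbabilityMeasure (cond sigma (D i)) := fun i =>
    cond_isProbabilityMeasure (sigma_cap_ne_zero _ hs hs')
  have hl : 0 ≤ Real.log (1 / (1 - s)) := by
    apply Real.log_nonneg
    rw [le_div_iff₀ (by linarith)]; linarith
  obtain ⟨hk0, -⟩ := kernelSum_eq hx₀
  have hNN : (0 : ℝ) ≤ N * (N - 1) := mul_nonneg (by linarith) (by linarith)
  have hJ := ofReal_exp_le_lintegral_distProd_rpow (Measure.pi fun i => cond sigma (D i))
    (by linarith : 0 ≤ β) (add_nonneg hk0 (mul_nonneg hNN hl))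
    (lintegral_kernelSum_le x₀ hs hs' hx₀)
  have hZ : (∏ i, sigma (D i)) * ∫⁻ z, ENNReal.ofReal (distProd N z ^ β)
      ∂(Measure.pi fun i => cond sigma (D i)) ≤ partitionFunction N β := by
    rw [← smul_eq_mul, ← lintegral_smul_measure,
      prod_smul_pi_cond D (fun i => measurableSet_cap _ _) fun i => sigma_cap_ne_zero _ hs hs',
      partitionFunction]
    simp_rw [weight_eq N (by linarith : 0 ≤ β)]
    exact setLIntegral_le_lintegral _ _
  refine le_trans ?_ hZ
  calc _ ≤ ENNReal.ofReal ((s / 17) ^ N) * ENNReal.ofReal (Real.exp (β * (N * (N - 1) *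
          Real.log 2 - (N * (N - 1) * Real.log 2 - Real.log (distProd N x₀) +
            N * (N - 1) * Real.log (1 / (1 - s)))))) := by
        rw [← ENNReal.ofReal_mul (by positivity)]
        apply ENNReal.ofReal_le_ofReal
        rw [← Real.exp_log (show 0 < (s / 17) ^ N by positivity), ← Real.exp_add]
        apply Real.exp_le_exp.2
        have hβ0 : 0 < β := by linarith
        have hN0 : (0 : ℝ) < N := by linarith
        have h1 : Real.log ((s / 17) ^ N) = N * (-Real.log β - Real.log N - Real.log 17) := by
          rw [Real.log_pow, Real.log_div hs.ne' (by norm_num), hs_def, one_div, Real.log_inv,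
            Real.log_mul hβ0.ne' hN0.ne']
          ring
        have h2 : β * (N * (N - 1) * Real.log (1 / (1 - s))) ≤ N := by
          have e : 1 / (1 - s) - 1 = 1 / (β * N - 1) := by
            have : β * N - 1 ≠ 0 := by linarith
            rw [hs_def]
            field_simp
            ring
          have h3 : Real.log (1 / (1 - s)) ≤ 1 / (β * N - 1) := by
            rw [← e]
            exact Real.log_le_sub_one_of_pos (one_div_pos.2 (by linarith))
          calc β * (N * (N - 1) * Real.log (1 / (1 - s)))
              ≤ β * (N * (N - 1) * (1 / (β * N - 1))) := by gcongr
            _ = N * ((β * (N - 1)) / (β * N - 1)) := by ring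
            _ ≤ N * 1 := by
              gcongr
              rw [div_le_one (by linarith)]
              linarith
            _ = N := mul_one _
        have h17 : Real.log 17 ≤ 5 * Real.log 2 := by
          rw [← Real.log_rpow two_pos]
          exact Real.log_le_log (by norm_num) (by norm_num)
        have hlogN : Real.log 2 ≤ Real.log N := Real.log_le_log two_pos hN'
        have hlog2 := Real.log_two_gt_d9
        have h4 : N * (Real.log 17 + 1) ≤ N * (7 * Real.log N) :=
          mul_le_mul_of_nonneg_left (by linarith) hN0.le
        rw [h1]
        linarith
    _ ≤ _ := by
        gcongr
        rw [ENNReal.ofReal_pow (by positivity)]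
        calc ENNReal.ofReal (s / 17) ^ N = ∏ _i : Fin N, ENNReal.ofReal (s / 17) := by simp
          _ ≤ _ := Finset.prod_le_prod' fun i _ => le_sigma_cap (x₀ i) hs hs'

/-! ### The ground state -/

lemma exists_injective_fin_S2 (N : ℕ) : ∃ x : Fin N → S2, Function.Injective x := by
  have hinf : Infinite S2 := by
    refine Infinite.of_injective (fun n : ℕ => (⟨!₂[Real.cos (1 / (n + 1)), Real.sin (1 / (n + 1)),
      0], ?_⟩ : S2)) ?_
    · rw [mem_sphere_zero_iff_norm, EuclideanSpace.norm_eq, Fin.sum_univ_three]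
      simp
    · intro m n h
      have h0 := congrArg (fun v : S2 => (v : E3) 0) h
      have hmem : ∀ k : ℕ, (1 / ((k : ℝ) + 1)) ∈ Set.Icc 0 Real.pi := fun k =>
        ⟨by positivity, le_trans (by
          rw [div_le_one (by positivity)]
          linarith [(Nat.cast_nonneg k : (0 : ℝ) ≤ k)]) (by linarith [Real.pi_gt_three])⟩
      have h1 := Real.injOn_cos (hmem m) (hmem n) (by simpa using h0)
      simpa using h1
  exact ⟨_, ((Fin.valEmbedding).trans (Infinite.natEmbedding S2)).injective⟩

lemma exists_distProd_isMax (N : ℕ) :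
    ∃ x₀ : Fin N → S2, 0 < distProd N x₀ ∧ ∀ x, distProd N x ≤ distProd N x₀ := by
  obtain ⟨x₁, hx₁⟩ := exists_injective_fin_S2 N
  have : Nonempty (Fin N → S2) := ⟨x₁⟩
  obtain ⟨x₀, -, hx₀⟩ := isCompact_univ.exists_isMaxOn Set.univ_nonempty
    (continuous_distProd N).continuousOn
  exact ⟨x₀, (distProd_pos_of_injective hx₁).trans_le (hx₀ (Set.mem_univ _)),
    fun x => hx₀ (Set.mem_univ x)⟩

/-! ### The Gibbs measure -/

lemma measurable_energy (N : ℕ) : Measurable (energy N) := by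
  have : energy N = fun x => -ENNReal.log (ENNReal.ofReal (distProd N x)) :=
    funext (energy_eq_neg_log N)
  rw [this]
  have := (continuous_distProd N).measurable
  fun_prop

lemma measurable_weight (N : ℕ) {β : ℝ} (hβ : 0 ≤ β) : Measurable (weight N β) := by
  have : weight N β = fun x => ENNReal.ofReal (distProd N x ^ β) := funext (weight_eq N hβ)
  rw [this]
  exact (continuous_distProd_rpow N hβ).measurable.ennreal_ofReal

/-- The partition function as a real number. -/
def realPartition (N : ℕ) (β : ℝ) : ℝ :=
  ∫ x, distProd N x ^ β ∂(Measure.pi fun _ : Fin N => sigma)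

lemma partitionFunction_eq (N : ℕ) {β : ℝ} (hβ : 0 ≤ β) :
    partitionFunction N β = ENNReal.ofReal (realPartition N β) := by
  unfold partitionFunction realPartition
  simp_rw [weight_eq N hβ]
  rw [ofReal_integral_eq_lintegral_ofReal
    (integrable_of_continuous (continuous_distProd_rpow N hβ))
    (ae_of_all _ fun z => Real.rpow_nonneg (distProd_nonneg z) β)]

lemma le_realPartition {N : ℕ} (hN : 2 ≤ N) {β : ℝ} (hβ : 1 ≤ β) {x₀ : Fin N → S2}
    (hx₀ : 0 < distProd N x₀) :
    Real.exp (β * Real.log (distProd N x₀) - N * (Real.log β + 8 * Real.log N)) ≤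
      realPartition N β := by
  have h := le_partitionFunction hN hβ hx₀
  rw [partitionFunction_eq N (by linarith)] at h
  exact (ENNReal.ofReal_le_ofReal_iff (integral_nonneg fun z =>
    Real.rpow_nonneg (distProd_nonneg z) β)).1 h

lemma integral_coulombGas (N : ℕ) {β : ℝ} (hβ : 0 ≤ β) (hZ : 0 < realPartition N β)
    (f : (Fin N → S2) → ℝ) :
    ∫ x, f x ∂(coulombGas N β) = (realPartition N β)⁻¹ *
      ∫ x, distProd N x ^ β * f x ∂(Measure.pi fun _ : Fin N => sigma) := by
  rw [coulombGas, integral_smul_measure, integral_withDensity_eq_integral_toReal_smul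
    (measurable_weight N hβ) (ae_of_all _ fun x => by rw [weight_eq N hβ]; exact
      ENNReal.ofReal_lt_top), partitionFunction_eq N hβ, ENNReal.toReal_inv,
    ENNReal.toReal_ofReal hZ.le, smul_eq_mul]
  congr 2
  ext x
  rw [weight_eq N hβ, ENNReal.toReal_ofReal (Real.rpow_nonneg (distProd_nonneg x) β), smul_eq_mul]

lemma integrable_coulombGas (N : ℕ) {β : ℝ} (hβ : 0 ≤ β) (hZ : 0 < realPartition N β)
    {f : (Fin N → S2) → ℝ} (hf : Continuous fun x => distProd N x ^ β * f x) :
    Integrable f (coulombGas N β) := by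
  refine Integrable.smul_measure ?_ ?_
  · rw [integrable_withDensity_iff_integrable_smul' (measurable_weight N hβ)
      (ae_of_all _ fun x => by rw [weight_eq N hβ]; exact ENNReal.ofReal_lt_top)]
    refine (integrable_of_continuous hf).congr (ae_of_all _ fun x => ?_)
    simp only
    rw [weight_eq N hβ, ENNReal.toReal_ofReal (Real.rpow_nonneg (distProd_nonneg x) β),
      smul_eq_mul]
  · rw [partitionFunction_eq N hβ]
    simpa using hZ

lemma isProbabilityMeasure_coulombGas (N : ℕ) {β : ℝ} (hβ : 0 ≤ β)
    (hZ : 0 < realPartition N β) : IsProbabilityMeasure (coulombGas N β) := by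
  constructor
  rw [coulombGas, Measure.smul_apply, withDensity_apply _ MeasurableSet.univ, Measure.restrict_univ]
  change _ * partitionFunction N β = 1
  rw [partitionFunction_eq N hβ]
  exact ENNReal.inv_mul_cancel (by simpa using hZ) ENNReal.ofReal_ne_top

/-- For `1 ≤ β`, the function `t ^ β * log t` is the product of `t ^ (β - 1)` and `t * log t`, both
continuous on `[0, ∞)`. -/
lemma continuous_distProd_rpow_mul_log (N : ℕ) {β : ℝ} (hβ : 1 ≤ β) :
    Continuous fun x => distProd N x ^ β * Real.log (distProd N x) := by
  have h : (fun x => distProd N x ^ β * Real.log (distProd N x)) =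
      fun x => distProd N x ^ (β - 1) * (distProd N x * Real.log (distProd N x)) := by
    ext x
    rw [← mul_assoc]
    congr 1
    conv_lhs => rw [← sub_add_cancel β 1]
    rw [Real.rpow_add_one' (distProd_nonneg x) (by linarith)]
  rw [h]
  exact (continuous_distProd_rpow N (by linarith)).mul
    (Real.continuous_mul_log.comp (continuous_distProd N))

/-- The Gibbs variational inequality. It is the integrated form of `log t ≤ t - 1` at
`t = Z / F ^ β`, where `F = distProd N x`. -/
lemma mul_integral_energy_le (N : ℕ) {β : ℝ} (hβ : 1 ≤ β) (hZ : 0 < realPartition N β) :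
    β * ∫ x, (energy N x).toReal ∂(coulombGas N β) ≤ -Real.log (realPartition N β) := by
  set Z := realPartition N β with hZdef
  have hβ0 : 0 < β := by linarith
  set ρ : Measure (Fin N → S2) := Measure.pi fun _ : Fin N => sigma with hρ
  have hc1 : Integrable (fun x => distProd N x ^ β) ρ :=
    integrable_of_continuous (continuous_distProd_rpow N hβ0.le)
  have hc2 : Integrable (fun x => distProd N x ^ β * Real.log (distProd N x)) ρ :=
    integrable_of_continuous (continuous_distProd_rpow_mul_log N hβ)
  have hpt : ∀ x : Fin N → S2, Real.log Z * distProd N x ^ β -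
      β * (distProd N x ^ β * Real.log (distProd N x)) ≤ Z - distProd N x ^ β := by
    intro x
    rcases (distProd_nonneg x).eq_or_lt' with h | h
    -- where `F = 0` the inequality reads `0 ≤ Z`
    · simp [h, Real.zero_rpow hβ0.ne', hZ.le]
    · have hw : 0 < distProd N x ^ β := Real.rpow_pos_of_pos h β
      have hlog := Real.log_le_sub_one_of_pos (div_pos hZ hw)
      rw [Real.log_div hZ.ne' hw.ne', Real.log_rpow h] at hlog
      have := mul_le_mul_of_nonneg_left hlog hw.le
      rw [mul_sub (distProd N x ^ β) (Z / _), mul_div_cancel₀ _ hw.ne'] at this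
      linarith
  have hI := integral_mono ((hc1.const_mul (Real.log Z)).sub (hc2.const_mul β))
    ((integrable_const Z).sub hc1) hpt
  rw [integral_sub' (hc1.const_mul _) (hc2.const_mul _), integral_const_mul, integral_const_mul,
    integral_sub' (integrable_const Z) hc1, integral_const, probReal_univ, one_smul] at hI
  have hZi : ∫ x, distProd N x ^ β ∂ρ = Z := rfl
  rw [hZi, sub_self] at hI
  simp_rw [energy_toReal]
  rw [integral_coulombGas N hβ0.le hZ]
  simp_rw [mul_neg]
  rw [integral_neg]
  set J := ∫ x, distProd N x ^ β * Real.log (distProd N x) ∂ρ with hJ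
  change β * (Z⁻¹ * -J) ≤ _
  rw [show β * (Z⁻¹ * -J) = (-(β * J)) / Z by field_simp, div_le_iff₀ hZ]
  linarith

lemma ae_energy_ne_top (N : ℕ) {β : ℝ} (hβ : 0 < β) :
    ∀ᵐ x ∂(coulombGas N β), energy N x ≠ ⊤ := by
  refine Measure.ae_smul_measure ?_ _
  rw [ae_withDensity_iff (measurable_weight N hβ.le)]
  refine ae_of_all _ fun x hx h => hx ?_
  have h0 : distProd N x = 0 := by
    by_contra h0
    rw [energy_eq_coe ((distProd_nonneg x).lt_of_ne' h0)] at h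
    exact EReal.coe_ne_top _ h
  rw [weight_eq N hβ.le, h0, Real.zero_rpow hβ.ne', ENNReal.ofReal_zero]

/-- Markov's inequality for the Gibbs measure: the weight is at most `exp (-β * a)` where the energy
exceeds `a`. -/
lemma coulombGas_real_lt_energy_le (N : ℕ) {β : ℝ} (hβ : 0 < β) (hZ : 0 < realPartition N β)
    (a : ℝ) :
    (coulombGas N β).real {x | (a : EReal) < energy N x} ≤
      Real.exp (-(β * a)) / realPartition N β := by
  have hmeas : MeasurableSet {x | (a : EReal) < energy N x} :=
    measurableSet_lt measurable_const (measurable_energy N)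
  refine ENNReal.toReal_le_of_le_ofReal (by positivity) ?_
  rw [coulombGas, Measure.smul_apply, withDensity_apply _ hmeas, smul_eq_mul,
    partitionFunction_eq N hβ.le, div_eq_inv_mul, ENNReal.ofReal_mul (by positivity),
    ENNReal.ofReal_inv_of_pos hZ]
  gcongr
  calc _ ≤ ∫⁻ x in {x | (a : EReal) < energy N x}, ENNReal.ofReal (Real.exp (-(β * a)))
        ∂(Measure.pi fun _ : Fin N => sigma) := by
        refine setLIntegral_mono' hmeas fun x hx => ?_
        rw [weight_eq N hβ.le]
        apply ENNReal.ofReal_le_ofReal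
        rcases (distProd_nonneg x).eq_or_lt' with h | h
        · rw [h, Real.zero_rpow hβ.ne']; positivity
        · have hx' : (a : EReal) < energy N x := hx
          rw [energy_eq_coe h, EReal.coe_lt_coe_iff] at hx'
          rw [Real.rpow_def_of_pos h]
          apply Real.exp_le_exp.2
          nlinarith
    _ ≤ _ := by
        rw [setLIntegral_const]
        exact mul_le_of_le_one_right' prob_le_one

end SphereGas

end

open SphereGas in
theorem theorem1 (N : ℕ) (hN : 2 ≤ N) (β : ℝ) (hβ : 1 ≤ β) :
    IsProbabilityMeasure (SphereGas.coulombGas N β) ∧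
    ∃ m : ℝ, IsLeast (Set.range (SphereGas.energy N)) (m : EReal) ∧
      (∀ c : ℝ, 0 < c → ∀ κ : ℝ,
        κ = c * (β / N) * Real.log N - Real.log β - 8 * Real.log N →
        1 - Real.exp (-(κ * N)) ≤
          (SphereGas.coulombGas N β).real
            {x | SphereGas.energy N x - (m : EReal) ≤ ((c * Real.log N : ℝ) : EReal)}) ∧
      (∀ᵐ x ∂(SphereGas.coulombGas N β), SphereGas.energy N x ≠ ⊤) ∧
      Integrable (fun x => (SphereGas.energy N x).toReal) (SphereGas.coulombGas N β) ∧
      (∫ x, (SphereGas.energy N x).toReal ∂(SphereGas.coulombGas N β)) - m ≤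
        (N / β) * (Real.log β + 8 * Real.log N) := by
  obtain ⟨x₀, hx₀, hmax⟩ := exists_distProd_isMax N
  have hZle := le_realPartition hN hβ hx₀
  have hZ : 0 < realPartition N β := (Real.exp_pos _).trans_le hZle
  have hβ0 : 0 < β := by linarith
  have hN0 : (0 : ℝ) < N := by exact_mod_cast (by omega : 0 < N)
  have hprob := isProbabilityMeasure_coulombGas N hβ0.le hZ
  set m : ℝ := -Real.log (distProd N x₀) with hm
  refine ⟨hprob, m, ⟨⟨x₀, energy_eq_coe hx₀⟩, ?_⟩, ?_, ae_energy_ne_top N hβ0, ?_, ?_⟩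
  · rintro _ ⟨x, rfl⟩
    rcases (distProd_nonneg x).eq_or_lt' with h | h
    · rw [energy_eq_top h]; exact le_top
    · rw [energy_eq_coe h, EReal.coe_le_coe_iff]
      exact neg_le_neg (Real.log_le_log h (hmax x))
  · rintro c - κ rfl
    have hset : {x | energy N x - (m : EReal) ≤ ((c * Real.log N : ℝ) : EReal)} =
        {x | ((m + c * Real.log N : ℝ) : EReal) < energy N x}ᶜ := by
      ext x
      rcases (distProd_nonneg x).eq_or_lt' with h | h
      · simp [energy_eq_top h, -EReal.coe_mul, -EReal.coe_add, EReal.coe_lt_top]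
      · simp only [Set.mem_ofPred_eq, Set.mem_compl_iff, energy_eq_coe h, ← EReal.coe_sub,
          EReal.coe_le_coe_iff, EReal.coe_lt_coe_iff, not_lt]
        rw [sub_le_iff_le_add']
    rw [hset, probReal_compl_eq_one_sub
      (measurableSet_lt measurable_const (measurable_energy N))]
    refine sub_le_sub_left ((coulombGas_real_lt_energy_le N hβ0 hZ _).trans ?_) 1
    rw [div_le_iff₀ hZ]
    refine le_trans (le_of_eq ?_) (mul_le_mul_of_nonneg_left hZle (Real.exp_pos _).le)
    rw [← Real.exp_add]
    congr 1
    rw [hm]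
    field_simp
    ring
  · simp_rw [energy_toReal]
    refine integrable_coulombGas N hβ0.le hZ ?_
    simp_rw [mul_neg]
    exact (continuous_distProd_rpow_mul_log N hβ).neg
  · have h1 := mul_integral_energy_le N hβ hZ
    have h2 := (Real.le_log_iff_exp_le hZ).2 hZle
    rw [div_mul_eq_mul_div, le_div_iff₀ hβ0, hm]
    linarith
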